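/- Let $\mathbf a$ be an algebra (a nonempty set with finitary operations, in an arbitrary algebraic language), with universe $A$. A polynomial of $\mathbf a$ is a term operation of the expansion of $\mathbf a$ by a constant for each element of $A$. For congruences $\alpha,\beta$ of $\mathbf a$, an $\alpha,\beta$-matrix is a matrix $$\begin{bmatrix} p&q\\ r&s\end{bmatrix}=\begin{bmatrix} t(\mathbf x,\mathbf u)&t(\mathbf x,\mathbf v)\\ t(\mathbf y,\mathbf u)&t(\mathbf y,\mathbf v)\end{bmatrix}$$ where $t$ is a polynomial of $\mathbf a$ and $\mathbf x,\mathbf y,\mathbf u,\mathbf v$ are finite tuples from $A$ with $x_i\mathrel{\alpha}y_i$ and $u_j\mathrel{\beta}v_j$ for all $i,j$. Let $0$ be the equality relation and $1$ the total relation. The algebra $\mathbf a$ is *abelian* if $p=q$ implies $r=s$ for every $1,1$-matrix; *strongly rectangular* if $q=r$ implies $r=s$ for every $1,1$-matrix; and *strongly abelian* if it is both. For congruences $\alpha\le\beta$, $\beta$ is *strongly abelian over* $\alpha$ if for every $\beta,\beta$-matrix both $p\mathrel{\alpha}q\Rightarrow r\mathrel{\alpha}s$ and $q\mathrel{\alpha}r\Rightarrow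 r\mathrel{\alpha}s$ hold. The algebra $\mathbf a$ is *strongly solvable* if there is a finite chain of congruences $0=\theta_0\le\theta_1\le\dots\le\theta_n=1$ with $\theta_{i+1}$ strongly abelian over $\theta_i$ for each $i<n$. For an algebra $\mathbf b$, $\mathsf{HS}(\mathbf b)$ is the class of all homomorphic images of subalgebras of $\mathbf b$. **Lemma.** Suppose that every finitely generated subalgebra of $\mathbf a$ is strongly solvable and that every algebra in $\mathsf{HS}(\mathbf a^2)$ is abelian. Then every algebra in $\mathsf{HS}(\mathbf a)$ is strongly abelian. -/

import Mathlib

universe u v w w'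

namespace UAlg

open FirstOrder FirstOrder.Language

/-- The coordinatewise structure on `A × B`; for an algebraic language this is the direct product
of two algebras (the relation part is then vacuous). -/
instance prodStructure (L : FirstOrder.Language.{u, v}) (A : Type w) (B : Type w')
    [L.Structure A] [L.Structure B] : L.Structure (A × B) where
  funMap f x := (Structure.funMap f (fun i => (x i).1), Structure.funMap f (fun i => (x i).2))
  RelMap R x := Structure.RelMap R (fun i => (x i).1) ∧ Structure.RelMap R (fun i => (x i).2)

/-- `B` belongs to `HS(A)`: it is a homomorphic image of a subalgebra of `A`. -/
def InHS (L : FirstOrder.Language.{u, v}) (A : Type w) (B : Type w')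
    [L.Structure A] [L.Structure B] : Prop :=
  ∃ (S : L.Substructure A) (f : S →[L] B), Function.Surjective f

section

variable (L : FirstOrder.Language.{u, v}) {A : Type w} [L.Structure A]

/-- An equivalence relation on `A` that is compatible with all basic operations. -/
def IsCongruence (θ : Setoid A) : Prop :=
  ∀ (n : ℕ) (f : L.Functions n) (x y : Fin n → A),
    (∀ i, θ (x i) (y i)) → θ (Structure.funMap f x) (Structure.funMap f y)

/-- `[p q; r s]` is an `α,β`-matrix of `A`:
`p = t(a,u)`, `q = t(a,v)`, `r = t(b,u)`, `s = t(b,v)` for a polynomial `t` of `A`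
(a term in the language with a constant for each element of `A`) and tuples with
`a` coordinatewise `α`-related to `b` and `u` coordinatewise `β`-related to `v`. -/
def IsMatrix (α β : Setoid A) (p q r s : A) : Prop :=
  ∃ (m n : ℕ) (t : (L[[A]]).Term (Fin m ⊕ Fin n)) (a b : Fin m → A) (u v : Fin n → A),
    (∀ i, α (a i) (b i)) ∧ (∀ j, β (u j) (v j)) ∧
    p = t.realize (Sum.elim a u) ∧ q = t.realize (Sum.elim a v) ∧
    r = t.realize (Sum.elim b u) ∧ s = t.realize (Sum.elim b v)

/-- `β` is strongly abelian over `α`: modulo `α`, the `β,β`-matrices satisfy the term condition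
and the strong rectangularity condition. -/
def IsStronglyAbelianOver (α β : Setoid A) : Prop :=
  (∀ p q r s : A, IsMatrix L β β p q r s → α p q → α r s) ∧
  (∀ p q r s : A, IsMatrix L β β p q r s → α q r → α r s)

variable (A)

/-- The term condition for all `1,1`-matrices, `1` being the total relation. -/
def IsAbelian : Prop :=
  ∀ p q r s : A, IsMatrix L ⊤ ⊤ p q r s → p = q → r = s

/-- Strong rectangularity of all `1,1`-matrices. -/
def IsStronglyRectangular : Prop :=
  ∀ p q r s : A, IsMatrix L ⊤ ⊤ p q r s → q = r → r = s

/-- Abelian and strongly rectangular. -/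
def IsStronglyAbelian : Prop :=
  IsAbelian L A ∧ IsStronglyRectangular L A

/-- There is a finite chain `0 = θ₀ ≤ θ₁ ≤ ⋯ ≤ θₙ = 1` of congruences of `A` in which each member
is strongly abelian over the preceding one. -/
def IsStronglySolvable : Prop :=
  ∃ (n : ℕ) (θ : Fin (n + 1) → Setoid A),
    θ 0 = ⊥ ∧ θ (Fin.last n) = ⊤ ∧ (∀ i, IsCongruence L (θ i)) ∧
    ∀ i : Fin n, θ i.castSucc ≤ θ i.succ ∧
      IsStronglyAbelianOver L (θ i.castSucc) (θ i.succ)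

end

end UAlg

/-!
Matrices are generated inductively, as a subalgebra of the fourth power, so that no polynomial has
to be written down; "abelian" is used in the form of the term condition modulo every congruence of
every subalgebra of a square (`SquareTermCondition`).

A matrix of `B ∈ HS(A)` lifts to a finitely generated, hence strongly solvable, subalgebra `S` of
`A`. As `B` is abelian, it suffices that for every congruence `θ` of `S` each matrix `[p q; r s]` of
`S` with `q θ r` satisfies `p θ q`.

The engine is `rel_of_translate`. Suppose the rows of the matrix come from tuples `x`, `y` that are
related by `R ≤ S × S`. In the algebra `R` the congruence generated by `(p, r)` and `(q, s)`
identifies `(p, p)` and `(q, q)`: replace `(x, y)` by `(x, x)` and use that the quotient is abelian.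
So a chain of translates `(f(p, c), f(r, c'))`, `(f(q, c), f(s, c'))` with `c R c'` connects `(p, p)`
to `(q, q)`, and since `S` is abelian modulo any congruence `δ`, the whole chain stays inside `δ`. If
each link stays in one `θ`-class in its first coordinate, then `p θ q`.

This is first applied to a congruence `β` that is strongly abelian over some `α ≤ θ`, with `R = β`
and `δ = α`: strong rectangularity turns `f(p, c) α f(r, c')` into `f(p, c) α f(r, c)`, which is
`θ`-related to `f(q, c)`. So `β` *rectangulates* modulo `θ`. With `δ = θ`, the same chain argument
shows that the relations that rectangulate modulo `θ` are closed under composition, so that `θ ∨ β`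
is a union of such relations, and that a matrix with `q θ r` satisfies `p θ q` as soon as `(p, q)`
lies in one of them. A descending induction along a chain that witnesses strong solvability, over
all congruences `θ` above its `i`-th member, finishes the proof.
-/

namespace UAlg

open FirstOrder FirstOrder.Language

/-! ### Compatible relations -/

section

variable (L : FirstOrder.Language.{u, v}) {A : Type w} [L.Structure A]

/-- A binary relation that is preserved by all basic operations, that is, a subuniverse of the
square of the algebra. -/
def Compatible (R : A → A → Prop) : Prop :=
  ∀ (n : ℕ) (f : L.Functions n) (x y : Fin n → A),
    (∀ i, R (x i) (y i)) → R (Structure.funMap f x) (Structure.funMap f y)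

variable {L}

theorem Compatible.eqvGen {R : A → A → Prop} (hrefl : ∀ a, R a a) (hR : Compatible L R) :
    Compatible L (Relation.EqvGen R) := by
  classical
  intro n f x y hxy
  have step : ∀ (i : Fin n) (a b : A), Relation.EqvGen R a b → ∀ z : Fin n → A,
      Relation.EqvGen R (Structure.funMap f (Function.update z i a))
        (Structure.funMap f (Function.update z i b)) := by
    intro i a b hab z
    induction hab with
    | rel a b h =>
      refine .rel _ _ (hR _ _ _ _ fun j => ?_)
      by_cases hj : j = i
      · subst hj; simpa using h
      · simpa [hj] using hrefl _
    | refl a => exact .refl _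
    | symm a b _ ih => exact .symm _ _ ih
    | trans a b c _ _ ih₁ ih₂ => exact .trans _ _ _ ih₁ ih₂
  have all : ∀ s : Finset (Fin n),
      Relation.EqvGen R (Structure.funMap f x) (Structure.funMap f (s.piecewise y x)) := by
    intro s
    induction s using Finset.induction_on with
    | empty => simpa using Relation.EqvGen.refl _
    | insert j s hj ih =>
      rw [Finset.piecewise_insert]
      refine .trans _ _ _ ih ?_
      have h := step j (x j) (y j) (hxy j) (s.piecewise y x)
      rwa [show Function.update (s.piecewise y x) j (x j) = s.piecewise y x by
        rw [Function.update_eq_iff]; simp [hj] ] at h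
  simpa [Finset.piecewise_univ] using all Finset.univ

theorem Compatible.comp {R S : A → A → Prop} (hR : Compatible L R) (hS : Compatible L S) :
    Compatible L (Relation.Comp R S) := by
  intro n f x y h
  choose z hz using h
  exact ⟨Structure.funMap f z, hR _ _ _ _ fun i => (hz i).1, hS _ _ _ _ fun i => (hz i).2⟩

/-- The subalgebra of the square whose universe is the given compatible relation. -/
def Compatible.toSubstructure {R : A → A → Prop} (hR : Compatible L R) :
    L.Substructure (A × A) where
  carrier := {z | R z.1 z.2}
  fun_mem f x hx := hR _ f (fun i => (x i).1) (fun i => (x i).2) hx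

end

/-! ### Matrices -/

section

variable (L : FirstOrder.Language.{u, v}) {A : Type w} [L.Structure A]

/-- The subalgebra of the fourth power of `A` generated by the matrices with constant rows
`[x x; y y]`, `α x y`, and those with constant columns `[u v; u v]`, `β u v`. For reflexive `α`
these are precisely the `α,β`-matrices; generating them inductively avoids all manipulation of
terms. The relations `α` and `β` need not be congruences. -/
inductive Matrix (α β : A → A → Prop) : A → A → A → A → Prop
  | row (x y : A) : α x y → Matrix α β x x y y
  | col (x y : A) : β x y → Matrix α β x y x y
  | app {n : ℕ} (f : L.Functions n) (p q r s : Fin n → A) :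
      (∀ i, Matrix α β (p i) (q i) (r i) (s i)) →
      Matrix α β (Structure.funMap f p) (Structure.funMap f q)
        (Structure.funMap f r) (Structure.funMap f s)

variable {L}

namespace Matrix

variable {α β α' β' : A → A → Prop} {p q r s : A}

theorem mono (hα : ∀ x y, α x y → α' x y) (hβ : ∀ x y, β x y → β' x y)
    (h : Matrix L α β p q r s) : Matrix L α' β' p q r s := by
  induction h with
  | row x y h => exact .row _ _ (hα _ _ h)
  | col x y h => exact .col _ _ (hβ _ _ h)
  | app f p q r s _ ih => exact .app f _ _ _ _ ih

theorem to_top (h : Matrix L α β p q r s) : Matrix L ⊤ ⊤ p q r s :=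
  h.mono (fun _ _ _ => trivial) (fun _ _ _ => trivial)

theorem transpose (h : Matrix L α β p q r s) : Matrix L β α p r q s := by
  induction h with
  | row x y h => exact .col _ _ h
  | col x y h => exact .row _ _ h
  | app f p q r s _ ih => exact .app f _ _ _ _ ih

theorem swap_rows (h : Matrix L α β p q r s) : Matrix L (flip α) β r s p q := by
  induction h with
  | row x y h => exact .row _ _ h
  | col x y h => exact .col _ _ h
  | app f p q r s _ ih => exact .app f _ _ _ _ ih

theorem swap_cols (h : Matrix L α β p q r s) : Matrix L α (flip β) q p s r :=
  h.transpose.swap_rows.transpose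

theorem map {B : Type w'} [L.Structure B] (g : A → B)
    (hg : ∀ (n : ℕ) (f : L.Functions n) (x : Fin n → A),
      g (Structure.funMap f x) = Structure.funMap f (fun i => g (x i)))
    (h : Matrix L α β p q r s) : Matrix L (⊤ : B → B → Prop) ⊤ (g p) (g q) (g r) (g s) := by
  induction h with
  | row x y h => exact .row _ _ trivial
  | col x y h => exact .col _ _ trivial
  | app f p q r s _ ih => simp only [hg]; exact .app f _ _ _ _ ih

theorem rel_left (hrefl : ∀ a, α a a) (hα : Compatible L α) (h : Matrix L α β p q r s) :
    α p r ∧ α q s := by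
  induction h with
  | row x y h => exact ⟨h, h⟩
  | col x y h => exact ⟨hrefl _, hrefl _⟩
  | app f p q r s _ ih =>
    exact ⟨hα _ _ _ _ fun i => (ih i).1, hα _ _ _ _ fun i => (ih i).2⟩

theorem realize {X : Type*} (t : L.Term X) (P Q R S : X → A)
    (h : ∀ x, Matrix L α β (P x) (Q x) (R x) (S x)) :
    Matrix L α β (t.realize P) (t.realize Q) (t.realize R) (t.realize S) := by
  induction t with
  | var x => exact h x
  | func f ts ih => exact .app f _ _ _ _ ih

theorem exists_term (h : Matrix L α β p q r s) :
    ∃ (ι κ : Type) (_ : Finite ι) (_ : Finite κ) (t : L.Term (ι ⊕ κ)) (a b : ι → A)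
      (c d : κ → A), (∀ i, α (a i) (b i)) ∧ (∀ j, β (c j) (d j)) ∧
      p = t.realize (Sum.elim a c) ∧ q = t.realize (Sum.elim a d) ∧
      r = t.realize (Sum.elim b c) ∧ s = t.realize (Sum.elim b d) := by
  induction h with
  | row x y h =>
    exact ⟨Unit, Empty, inferInstance, inferInstance, .var (.inl ()), fun _ => x, fun _ => y,
      Empty.elim, Empty.elim, fun _ => h, fun e => e.elim, rfl, rfl, rfl, rfl⟩
  | col x y h =>
    exact ⟨Empty, Unit, inferInstance, inferInstance, .var (.inr ()), Empty.elim, Empty.elim,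
      fun _ => x, fun _ => y, fun e => e.elim, fun _ => h, rfl, rfl, rfl, rfl⟩
  | app f p q r s _ ih =>
    choose ι κ hι hκ t a b c d hab hcd hp hq hr hs using ih
    have key : ∀ (a' : ∀ i, ι i → A) (c' : ∀ i, κ i → A),
        (Term.func f fun i => (t i).relabel (Sum.map (Sigma.mk i) (Sigma.mk i))).realize
          (Sum.elim (fun x : Σ i, ι i => a' x.1 x.2) (fun x : Σ i, κ i => c' x.1 x.2)) =
        Structure.funMap f fun i => (t i).realize (Sum.elim (a' i) (c' i)) := by
      intro a' c'
      simp only [Term.realize_func, Term.realize_relabel]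
      congr 1
      funext i
      congr 1
      funext x
      cases x <;> rfl
    refine ⟨Σ i, ι i, Σ i, κ i, inferInstance, inferInstance,
      .func f fun i => (t i).relabel (Sum.map (Sigma.mk i) (Sigma.mk i)),
      fun x => a x.1 x.2, fun x => b x.1 x.2, fun x => c x.1 x.2, fun x => d x.1 x.2,
      fun x => hab _ _, fun x => hcd _ _, ?_, ?_, ?_, ?_⟩ <;>
    · rw [key]
      congr 1
      funext i
      solve_by_elim

theorem isMatrix {α β : Setoid A} (h : Matrix L α β p q r s) : IsMatrix L α β p q r s := by
  obtain ⟨ι, κ, _, _, t, a, b, c, d, hab, hcd, hp, hq, hr, hs⟩ := h.exists_term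
  obtain ⟨m, ⟨e₁⟩⟩ := Finite.exists_equiv_fin ι
  obtain ⟨n, ⟨e₂⟩⟩ := Finite.exists_equiv_fin κ
  have key : ∀ (a' : ι → A) (c' : κ → A),
      ((lhomWithConstants L A).onTerm (t.relabel (Sum.map e₁ e₂))).realize
        (Sum.elim (a' ∘ e₁.symm) (c' ∘ e₂.symm)) = t.realize (Sum.elim a' c') := by
    intro a' c'
    rw [LHom.realize_onTerm, Term.realize_relabel]
    congr 1
    funext x
    cases x <;> simp
  exact ⟨m, n, (lhomWithConstants L A).onTerm (t.relabel (Sum.map e₁ e₂)), a ∘ e₁.symm,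
    b ∘ e₁.symm, c ∘ e₂.symm, d ∘ e₂.symm, fun i => hab _, fun j => hcd _,
    by rw [key, hp], by rw [key, hq], by rw [key, hr], by rw [key, hs]⟩

theorem of_isMatrix {α β : Setoid A} (h : IsMatrix L α β p q r s) : Matrix L α β p q r s := by
  obtain ⟨m, n, t, a, b, c, d, hab, hcd, rfl, rfl, rfl, rfl⟩ := h
  induction t with
  | var x =>
    cases x with
    | inl i => exact .row _ _ (hab i)
    | inr j => exact .col _ _ (hcd j)
  | @func k f ts ih =>
    cases f with
    | inl f =>
      exact .app (f : L.Functions k) (fun i => (ts i).realize _) (fun i => (ts i).realize _)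
        (fun i => (ts i).realize _) (fun i => (ts i).realize _) ih
    | inr f =>
      -- Only the constants of the expansion remain, and their value ignores the arguments.
      cases k with
      | zero =>
        have : ∀ v : Fin m ⊕ Fin n → A,
            (Term.func (L := L[[A]]) (Sum.inr f : (L[[A]]).Functions 0) ts).realize v =
              (f : A) := fun v => rfl
        simp only [this]
        exact .row _ _ (α.refl _)
      | succ k => exact (nomatch f)

end Matrix

end

/-! ### The term condition modulo congruences of subalgebras of the square -/

section

variable (L : FirstOrder.Language.{u, v}) (A : Type w) [L.Structure A]

/-- Modulo every congruence of every subalgebra of `A × A` the term condition holds. This says,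
without forming quotients, that `HS(A × A)` consists of abelian algebras. -/
def SquareTermCondition : Prop :=
  ∀ (C : L.Substructure (A × A)) (Ψ : Setoid C), IsCongruence L Ψ →
    ∀ p q r s : C, Matrix L ⊤ ⊤ p q r s → Ψ p q → Ψ r s

variable {L A}

/-- The quotient algebra by a congruence. -/
@[reducible] noncomputable def quotientStructure [L.IsAlgebraic] (Ψ : Setoid A) :
    L.Structure (Quotient Ψ) where
  funMap f x := ⟦Structure.funMap f fun i => (x i).out⟧
  RelMap R _ := isEmptyElim R

theorem quotientStructure_funMap [L.IsAlgebraic] {Ψ : Setoid A} (h : IsCongruence L Ψ) {n : ℕ}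
    (f : L.Functions n) (x : Fin n → A) :
    (⟦Structure.funMap f x⟧ : Quotient Ψ) =
      (quotientStructure (L := L) Ψ).funMap f fun i => ⟦x i⟧ :=
  Quotient.sound (h _ f _ _ fun _ => Ψ.symm (Quotient.mk_out (s := Ψ) _))

/-- An algebra homomorphism, given by its operation-preserving map. -/
def homOfFun [L.IsAlgebraic] {B : Type w'} [L.Structure B] (g : A → B)
    (hg : ∀ (n : ℕ) (f : L.Functions n) (x : Fin n → A),
      g (Structure.funMap f x) = Structure.funMap f (fun i => g (x i))) : A →[L] B where
  toFun := g
  map_fun' f x := hg _ f x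
  map_rel' R := isEmptyElim R

/-- The coordinatewise inclusion of the square of a subalgebra. -/
def squareEmbedding [L.IsAlgebraic] (S : L.Substructure A) : S × S ↪[L] A × A where
  toFun z := (z.1, z.2)
  inj' := by
    intro x y h
    exact Prod.ext (Subtype.ext (congrArg Prod.fst h)) (Subtype.ext (congrArg Prod.snd h))
  map_fun' f x := rfl
  map_rel' R := isEmptyElim R

theorem squareTermCondition_of_isAbelian [L.IsAlgebraic]
    (habel : ∀ (B : Type w) [L.Structure B], InHS L (A × A) B → IsAbelian L B)
    (S : L.Substructure A) : SquareTermCondition L S := by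
  intro C Ψ hΨ p q r s hM hpq
  let := quotientStructure (L := L) Ψ
  let π : C →[L] Quotient Ψ := homOfFun (fun c => ⟦c⟧) fun n f x => quotientStructure_funMap hΨ f x
  let e := (squareEmbedding S).substructureEquivMap C
  have hHS : InHS L (A × A) (Quotient Ψ) := by
    refine ⟨C.map (squareEmbedding S).toHom, π.comp e.symm.toHom, ?_⟩
    intro b
    obtain ⟨c, rfl⟩ := Quotient.exists_rep b
    exact ⟨e c, congrArg π (e.symm_apply_apply c)⟩
  have hmat : Matrix L (⊤ : Setoid (Quotient Ψ)) (⊤ : Setoid (Quotient Ψ)) ⟦p⟧ ⟦q⟧ ⟦r⟧ ⟦s⟧ :=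
    (hM.map (fun c => (⟦c⟧ : Quotient Ψ)) fun n f x => quotientStructure_funMap hΨ f x).mono
      (fun _ _ _ => trivial) (fun _ _ _ => trivial)
  exact Quotient.exact (habel _ hHS _ _ _ _ hmat.isMatrix (Quotient.sound hpq))

theorem SquareTermCondition.of_congruence (hA : SquareTermCondition L A) {δ : Setoid A}
    (hδ : IsCongruence L δ) {p q r s : A} (h : Matrix L ⊤ ⊤ p q r s) (hpq : δ p q) : δ r s :=
  hA ⊤ (δ.comap fun z => z.1.1) (fun n f _ _ hxy => hδ n f _ _ hxy) _ _ _ _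
    (h.map (fun a => (⟨(a, a), trivial⟩ : (⊤ : L.Substructure (A × A)))) fun _ _ _ => rfl) hpq

end

/-! ### Collapsing the two columns of a matrix -/

section

variable (L : FirstOrder.Language.{u, v}) {A : Type w} [L.Structure A]

/-- `Translate L R p r q s a b a' b'` means that one unary polynomial of the algebra `R ≤ A × A`
sends `(p, r)` to `(a, b)` and `(q, s)` to `(a', b')`. -/
inductive Translate (R : A → A → Prop) (p r q s : A) : A → A → A → A → Prop
  | base : Translate R p r q s p r q s
  | const (c c' : A) : R c c' → Translate R p r q s c c' c c'
  | app {n : ℕ} (f : L.Functions n) (a b a' b' : Fin n → A) :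
      (∀ i, Translate R p r q s (a i) (b i) (a' i) (b' i)) →
      Translate R p r q s (Structure.funMap f a) (Structure.funMap f b)
        (Structure.funMap f a') (Structure.funMap f b')

variable {L} {R R₁ R₂ W : A → A → Prop} {p q r s a b a' b' : A}

theorem Translate.matrix (hM : Matrix L ⊤ ⊤ p q r s) (h : Translate L R p r q s a b a' b') :
    Matrix L ⊤ ⊤ a a' b b' := by
  induction h with
  | base => exact hM
  | const c c' _ => exact .row _ _ trivial
  | app f a b a' b' _ ih => exact .app f _ _ _ _ ih

/-- Let `C` be the algebra `R ≤ A × A`. In `C` the columns `(p, r)` and `(q, s)` of the matrix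
form the first row of a matrix whose second row is `(p, p)`, `(q, q)`. -/
theorem Matrix.columns (hrefl : ∀ a, R a a) (hR : Compatible L R) (h : Matrix L R ⊤ p q r s) :
    ∃ (h₁ : R p r) (h₂ : R q s), Matrix L (⊤ : hR.toSubstructure → _ → Prop) ⊤
      ⟨(p, r), h₁⟩ ⟨(q, s), h₂⟩ ⟨(p, p), hrefl p⟩ ⟨(q, q), hrefl q⟩ := by
  induction h with
  | row x y h => exact ⟨h, h, .row _ _ trivial⟩
  | col x y h => exact ⟨hrefl _, hrefl _, .col _ _ trivial⟩
  | app f p q r s _ ih =>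
    choose h₁ h₂ h₃ using ih
    exact ⟨hR _ _ _ _ h₁, hR _ _ _ _ h₂, .app f _ _ _ _ h₃⟩

/-- The congruence of `R ≤ A × A` generated by the columns `(p, r)` and `(q, s)` of a matrix also
identifies `(p, p)` with `(q, q)`, since the quotient is abelian. By abelianness modulo `δ`, the
restriction of `δ` to `R` is saturated for this congruence; so the diagonal pair `(p, p)` is joined
to `(q, q)` by translates that stay inside `δ`, and it suffices to control those. -/
theorem rel_of_translate (hA : SquareTermCondition L A) (hrefl : ∀ a, R a a)
    (hR : Compatible L R) {δ θ : Setoid A} (hδ : IsCongruence L δ)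
    (hM : Matrix L R ⊤ p q r s)
    (h : ∀ a b a' b', Translate L R p r q s a b a' b' → δ a b → θ a a') : θ p q := by
  let T : hR.toSubstructure → hR.toSubstructure → Prop :=
    fun z z' => Translate L R p r q s z.1.1 z.1.2 z'.1.1 z'.1.2
  obtain ⟨h₁, h₂, hC⟩ := hM.columns hrefl hR
  have hΨ : IsCongruence L (Relation.EqvGen.setoid T) :=
    Compatible.eqvGen (fun z => .const _ _ z.2) fun n f x y hxy => .app f _ _ _ _ hxy
  have hpq : Relation.EqvGen T ⟨(p, p), hrefl p⟩ ⟨(q, q), hrefl q⟩ :=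
    hA _ _ hΨ _ _ _ _ hC (.rel _ _ .base)
  have sat : ∀ z z', Relation.EqvGen T z z' →
      (δ z.1.1 z.1.2 ↔ δ z'.1.1 z'.1.2) ∧ (δ z.1.1 z.1.2 → θ z.1.1 z'.1.1) := by
    intro z z' hz
    induction hz with
    | rel z z' hz =>
      have hm := hz.matrix hM.to_top
      exact ⟨⟨hA.of_congruence hδ hm.transpose,
        hA.of_congruence hδ hm.transpose.swap_rows⟩, h _ _ _ _ hz⟩
    | refl z => exact ⟨Iff.rfl, fun _ => θ.refl _⟩
    | symm z z' _ ih => exact ⟨ih.1.symm, fun hz => θ.symm (ih.2 (ih.1.2 hz))⟩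
    | trans x y z _ _ ih₁ ih₂ =>
      exact ⟨ih₁.1.trans ih₂.1, fun hx => θ.trans (ih₁.2 hx) (ih₂.2 (ih₁.1.1 hx))⟩
  exact (sat _ _ hpq).2 (δ.refl p)

/-! ### Relations that rectangulate the algebra -/

variable (L) in
/-- `R` is a reflexive compatible relation, and in every `R,1`-matrix with `q θ r` the upper row is
collapsed by `θ`. When `A` is abelian modulo `θ`, this is strong rectangularity modulo `θ` of the
`R,1`-matrices. -/
structure Rectangulates (θ : Setoid A) (R : A → A → Prop) : Prop where
  refl : ∀ a, R a a
  compatible : Compatible L R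
  rel : ∀ p q r s, Matrix L R ⊤ p q r s → θ q r → θ p q

namespace Rectangulates

variable {θ : Setoid A}

theorem rel_left_col (hA : SquareTermCondition L A) (hθ : IsCongruence L θ)
    (hR : Rectangulates L θ R) (hM : Matrix L R ⊤ p q r s) (h : θ p s) : θ p r :=
  θ.trans h (hA.of_congruence hθ hM.to_top.swap_cols (hR.rel _ _ _ _ hM.swap_cols h))

theorem self (hθ : IsCongruence L θ) : Rectangulates L θ θ where
  refl := θ.refl
  compatible := hθ
  rel _ _ _ _ hM hqr := θ.trans (hM.rel_left θ.refl hθ).1 (θ.symm hqr)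

theorem flip (hA : SquareTermCondition L A) (hθ : IsCongruence L θ)
    (hR : Rectangulates L θ R) : Rectangulates L θ (flip R) where
  refl := hR.refl
  compatible n f x y h := hR.compatible n f y x h
  rel p q r s hM hqr := by
    have hsr : θ s r := hR.rel _ _ _ _ hM.swap_rows.swap_cols (θ.symm hqr)
    exact θ.symm (hA.of_congruence hθ hM.to_top.swap_rows.swap_cols hsr)

end Rectangulates

theorem Matrix.exists_of_comp (h : Matrix L (Relation.Comp R₁ R₂) ⊤ p q r s) :
    ∃ m m', Matrix L R₁ ⊤ p q m m' ∧ Matrix L R₂ ⊤ m m' r s := by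
  induction h with
  | row x y h =>
    obtain ⟨z, h₁, h₂⟩ := h
    exact ⟨z, z, .row _ _ h₁, .row _ _ h₂⟩
  | col x y h => exact ⟨x, y, .col _ _ h, .col _ _ h⟩
  | app f p q r s _ ih =>
    choose m m' h₁ h₂ using ih
    exact ⟨_, _, .app f _ _ _ _ h₁, .app f _ _ _ _ h₂⟩

namespace Rectangulates

variable {θ : Setoid A}

/-- A translate `f` of the matrix of the first step that stays inside `θ` cannot distinguish the
rows of that first step modulo `θ`, as `R₁` rectangulates. Hence `f` turns the coincidence
`q θ r`, which spans both steps, into one for the second step alone. -/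
theorem comp (hA : SquareTermCondition L A) (hθ : IsCongruence L θ)
    (h₁ : Rectangulates L θ R₁) (h₂ : Rectangulates L θ R₂) :
    Rectangulates L θ (Relation.Comp R₁ R₂) where
  refl a := ⟨a, h₁.refl a, h₂.refl a⟩
  compatible := h₁.compatible.comp h₂.compatible
  rel p q r s hM hqr := by
    obtain ⟨m, m', hM₁, hM₂⟩ := hM.exists_of_comp
    refine rel_of_translate hA h₁.refl h₁.compatible hθ hM₁ fun a b a' b' hT hab => ?_
    have inv : ∃ e e' g g' h, Matrix L R₁ ⊤ a h e b ∧ Matrix L ⊤ ⊤ a a' e e' ∧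
        Matrix L R₂ ⊤ e e' g g' ∧ θ a' g := by
      clear hab
      induction hT with
      | base =>
        exact ⟨m, m', r, s, p, .row _ _ (hM₁.rel_left h₁.refl h₁.compatible).1, hM₁.to_top,
          hM₂, hqr⟩
      | const c c' _ =>
        exact ⟨c, c, c, c, c', .col _ _ trivial, .row _ _ trivial, .row _ _ (h₂.refl c),
          θ.refl c⟩
      | app f a b a' b' _ ih =>
        choose e e' g g' h k₁ k₂ k₃ k₄ using ih
        exact ⟨_, _, _, _, _, .app f _ _ _ _ k₁, .app f _ _ _ _ k₂, .app f _ _ _ _ k₃,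
          hθ _ f _ _ k₄⟩
    obtain ⟨e, e', g, g', h, k₁, k₂, k₃, k₄⟩ := inv
    have hae : θ a e := h₁.rel_left_col hA hθ k₁ hab
    have hae' : θ a' e' := hA.of_congruence hθ k₂.transpose hae
    have hee' : θ e e' := h₂.rel _ _ _ _ k₃ (θ.trans (θ.symm hae') k₄)
    exact θ.trans hae (θ.trans hee' (θ.symm hae'))

theorem exists_of_eqvGen (hA : SquareTermCondition L A) (hθ : IsCongruence L θ)
    (hR : Rectangulates L θ R) (h : Relation.EqvGen R a b) :
    ∃ W, Rectangulates L θ W ∧ W a b := by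
  induction h with
  | rel a b h => exact ⟨R, hR, h⟩
  | refl a => exact ⟨R, hR, hR.refl a⟩
  | symm a b _ ih =>
    obtain ⟨W, hW, h⟩ := ih
    exact ⟨_, hW.flip hA hθ, h⟩
  | trans a b c _ _ ih₁ ih₂ =>
    obtain ⟨W₁, hW₁, k₁⟩ := ih₁
    obtain ⟨W₂, hW₂, k₂⟩ := ih₂
    exact ⟨_, hW₁.comp hA hθ hW₂, b, k₁, k₂⟩

/-- The rows of the matrix are unrestricted here; instead its upper row lies in a relation that
rectangulates. A translate `f(p, c) θ f(r, c')` then gives `f(p, c) θ f(q, c')`, a coincidence in a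
matrix whose rows arise from `p` and `q`. -/
theorem rel_of_rel (hA : SquareTermCondition L A) (hθ : IsCongruence L θ)
    (hW : Rectangulates L θ W) (hM : Matrix L ⊤ ⊤ p q r s) (hpq : W p q) (hqr : θ q r) :
    θ p q := by
  refine rel_of_translate hA (R := ⊤) (fun _ => trivial) (fun _ _ _ _ _ => trivial) hθ hM
    fun a b a' b' hT hab => ?_
  have inv : ∃ h g, Matrix L W ⊤ a h a' g ∧ θ g b := by
    clear hab
    induction hT with
    | base => exact ⟨p, q, .row _ _ hpq, hqr⟩
    | const c c' _ => exact ⟨c', c', .col _ _ trivial, θ.refl _⟩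
    | app f a b a' b' _ ih =>
      choose h g k₁ k₂ using ih
      exact ⟨_, _, .app f _ _ _ _ k₁, hθ _ f _ _ k₂⟩
  obtain ⟨h, g, k₁, k₂⟩ := inv
  exact hW.rel_left_col hA hθ k₁ (θ.trans hab (θ.symm k₂))

/-- The translates are controlled modulo `α`, where the `β,β`-matrices are strongly rectangular:
`f(p, c) α f(r, c')` gives `f(p, c) α f(r, c)`, and the latter is `θ`-related to `f(q, c)`. -/
theorem of_isStronglyAbelianOver (hA : SquareTermCondition L A) {α β : Setoid A}
    (hα : IsCongruence L α) (hβ : IsCongruence L β) (hθ : IsCongruence L θ)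
    (h : IsStronglyAbelianOver L α β) (hαθ : α ≤ θ) : Rectangulates L θ β where
  refl := β.refl
  compatible := hβ
  rel p q r s hM hqr := by
    refine rel_of_translate hA β.refl hβ hα hM fun a b a' b' hT hab => ?_
    have inv : ∃ e m, Matrix L β β a e m b ∧ θ e a' := by
      clear hab
      induction hT with
      | base => exact ⟨r, p, .col _ _ (hM.rel_left β.refl hβ).1, θ.symm hqr⟩
      | const c c' hc => exact ⟨c, c', .row _ _ hc, θ.refl _⟩
      | app f a b a' b' _ ih =>
        choose e m k₁ k₂ using ih
        exact ⟨_, _, .app f _ _ _ _ k₁, hθ _ f _ _ k₂⟩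
    obtain ⟨e, m, k₁, k₂⟩ := inv
    have k : Matrix L β β m b a e :=
      k₁.swap_rows.mono (fun _ _ h => β.symm h) (fun _ _ h => h)
    exact θ.trans (hαθ (h.2 _ _ _ _ k.isMatrix (α.symm hab))) k₂

end Rectangulates

/-- Descending induction along the chain: the `i`-th statement is about the congruences `θ` above
`θᵢ`. Passing from `θ ∨ θᵢ₊₁` down to `θ`, the join is exhausted by relations composed from `θ` and
`θᵢ₊₁`, all of which rectangulate modulo `θ`. -/
theorem IsStronglySolvable.rectangulates_top (h : IsStronglySolvable L A)
    (hA : SquareTermCondition L A) {θ : Setoid A} (hθ : IsCongruence L θ) :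
    Rectangulates L θ ⊤ := by
  obtain ⟨n, χ, h_bot, h_top, hχ, hstep⟩ := h
  have main : ∀ i : Fin (n + 1), ∀ θ : Setoid A, IsCongruence L θ → χ i ≤ θ →
      Rectangulates L θ ⊤ := by
    intro i
    induction i using Fin.reverseInduction with
    | last =>
      intro θ _ hle
      rw [h_top] at hle
      exact ⟨fun _ => trivial, fun _ _ _ _ _ => trivial, fun _ _ _ _ _ _ => hle trivial⟩
    | cast i ih =>
      intro θ hθ hle
      have hβ : Rectangulates L θ (χ i.succ) :=
        .of_isStronglyAbelianOver hA (hχ _) (hχ _) hθ (hstep i).2 hle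
      have hcomp := (Rectangulates.self hθ).comp hA hθ hβ
      let J : Setoid A := Relation.EqvGen.setoid (Relation.Comp θ (χ i.succ))
      have hJ : IsCongruence L J := Compatible.eqvGen hcomp.refl hcomp.compatible
      have hJtop := ih J hJ fun {x y} hxy => Relation.EqvGen.rel _ _ ⟨x, θ.refl x, hxy⟩
      refine ⟨fun _ => trivial, fun _ _ _ _ _ => trivial, fun p q r s hM hqr => ?_⟩
      have hpq : J p q := hJtop.rel _ _ _ _ hM (.rel _ _ ⟨r, hqr, (χ i.succ).refl r⟩)
      obtain ⟨W, hW, hWpq⟩ := hcomp.exists_of_eqvGen hA hθ hpq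
      exact hW.rel_of_rel hA hθ hM hWpq hqr
  exact main 0 θ hθ (h_bot ▸ bot_le)

end

/-! ### Homomorphic images of subalgebras -/

section

variable {L : FirstOrder.Language.{u, v}} {A : Type w} [L.Structure A] {B : Type w'}
  [L.Structure B]

theorem InHS.square [L.IsAlgebraic] (h : InHS L A B) : InHS L (A × A) B := by
  obtain ⟨S, f, hf⟩ := h
  let π : A × A →[L] A := homOfFun Prod.fst fun _ _ _ => rfl
  let g : S.comap π →[L] S := homOfFun (fun z => ⟨z.1.1, z.2⟩) fun _ _ _ => rfl
  refine ⟨S.comap π, f.comp g, fun b => ?_⟩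
  obtain ⟨a, rfl⟩ := hf b
  exact ⟨⟨(a, a), a.2⟩, rfl⟩

/-- A matrix of a homomorphic image lifts to every subalgebra that contains a suitable finite
set. -/
theorem Matrix.exists_lift {S₀ : L.Substructure A} (f : S₀ →[L] B) (hf : Function.Surjective f)
    {p q r s : B} (h : Matrix L ⊤ ⊤ p q r s) :
    ∃ F : Set A, F.Finite ∧ F ⊆ S₀ ∧ ∀ (S : L.Substructure A) (hS : S ≤ S₀), F ⊆ S →
      ∃ p' q' r' s' : S, Matrix L ⊤ ⊤ p' q' r' s' ∧ f (Substructure.inclusion hS p') = p ∧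
        f (Substructure.inclusion hS q') = q ∧ f (Substructure.inclusion hS r') = r ∧
        f (Substructure.inclusion hS s') = s := by
  induction h with
  | row x y _ =>
    obtain ⟨a, rfl⟩ := hf x
    obtain ⟨b, rfl⟩ := hf y
    refine ⟨{↑a, ↑b}, by simp, by simp [Set.insert_subset_iff], fun S hS hF => ?_⟩
    exact ⟨⟨a, hF (by simp)⟩, ⟨a, hF (by simp)⟩, ⟨b, hF (by simp)⟩, ⟨b, hF (by simp)⟩,
      .row _ _ trivial, rfl, rfl, rfl, rfl⟩
  | col x y _ =>
    obtain ⟨a, rfl⟩ := hf x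
    obtain ⟨b, rfl⟩ := hf y
    refine ⟨{↑a, ↑b}, by simp, by simp [Set.insert_subset_iff], fun S hS hF => ?_⟩
    exact ⟨⟨a, hF (by simp)⟩, ⟨b, hF (by simp)⟩, ⟨a, hF (by simp)⟩, ⟨b, hF (by simp)⟩,
      .col _ _ trivial, rfl, rfl, rfl, rfl⟩
  | app φ p q r s _ ih =>
    choose F hfin hsub hlift using ih
    refine ⟨⋃ i, F i, Set.finite_iUnion hfin, Set.iUnion_subset hsub, fun S hS hF => ?_⟩
    choose p' q' r' s' hM hp hq hr hs using
      fun i => hlift i S hS ((Set.subset_iUnion F i).trans hF)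
    have key : ∀ (x' : _ → S) (x : _ → B), (∀ i, f (Substructure.inclusion hS (x' i)) = x i) →
        f (Substructure.inclusion hS (Structure.funMap φ x')) = Structure.funMap φ x := by
      intro x' x hx
      rw [Embedding.map_fun, Hom.map_fun]
      exact congrArg _ (funext hx)
    exact ⟨_, _, _, _, .app φ _ _ _ _ hM, key _ _ hp, key _ _ hq, key _ _ hr, key _ _ hs⟩

theorem isCongruence_ker (g : A →[L] B) : IsCongruence L (Setoid.ker g) := by
  intro n f x y h
  simp only [Setoid.ker_def] at h ⊢
  rw [g.map_fun, g.map_fun]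
  exact congrArg _ (funext h)

end

end UAlg

theorem lemma3p4 (L : FirstOrder.Language.{u, v}) [L.IsAlgebraic]
    (A : Type w) [L.Structure A]
    (hsolv : ∀ S : L.Substructure A, S.FG → UAlg.IsStronglySolvable L S)
    (habel : ∀ (B : Type w) [L.Structure B], UAlg.InHS L (A × A) B → UAlg.IsAbelian L B) :
    ∀ (B : Type w) [L.Structure B], UAlg.InHS L A B → UAlg.IsStronglyAbelian L B := by
  intro B _ hB
  have hBab : UAlg.IsAbelian L B := habel B hB.square
  refine ⟨hBab, fun p q r s hM hqr => ?_⟩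
  obtain ⟨S₀, f, hf⟩ := hB
  obtain ⟨F, hfin, hsub, hlift⟩ := (UAlg.Matrix.of_isMatrix hM).to_top.exists_lift f hf
  have hS : FirstOrder.Language.Substructure.closure L F ≤ S₀ :=
    FirstOrder.Language.Substructure.closure_le.2 hsub
  obtain ⟨p', q', r', s', hM', rfl, rfl, rfl, rfl⟩ :=
    hlift _ hS FirstOrder.Language.Substructure.subset_closure
  have hrect := (hsolv _ (FirstOrder.Language.Substructure.fg_closure hfin)).rectangulates_top
    (UAlg.squareTermCondition_of_isAbelian habel _)
    (UAlg.isCongruence_ker (f.comp (FirstOrder.Language.Substructure.inclusion hS).toHom))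
  exact hBab _ _ _ _ hM (hrect.rel _ _ _ _ hM' hqr)
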